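/- **Lower bound of 6 for online maximum clique clustering (MaxCC).** A clique clustering of a finite simple graph $G$ is a partition $\mathcal C=\{C_1,\dots,C_k\}$ of its vertex set into cliques of $G$; its profit is $\sum_{i}\binom{|C_i|}{2}$, and $\mathrm{profit}_{\mathrm{OPT}}(G)$ is the maximum profit of a clique clustering of $G$. In the online problem the vertices $v_1,v_2,\dots,v_n$ of $G$ arrive one at a time, each together with its edges to the preceding vertices; $n$ is not known in advance. A deterministic online strategy $\mathcal S$ maintains a clique clustering of the graph revealed so far: when a vertex arrives, it becomes a singleton cluster, and then $\mathcal S$ may merge any number of clusters, provided that all clusters are cliques; clusters are never split. The decisions of $\mathcal S$ depend only on the graph revealed so far (there are no computational restrictions). Let $\mathrm{profit}_{\mathcal S}(G)$ be the profit of the clustering held by $\mathcal S$ after all vertices of $G$ have arrived. The strategy $\mathcal S$ is $R$-competitive ($R\in\mathbb R$) if there is a constant $\beta\in\mathbb R$ with $$R\cdot \mathrm{profit}_{\mathcal S}(G)+\beta\ \ge\ \mathrm{profit}_{\mathrm{OPT}}(G)\qquad\text{for every input graph } G .$$ The (asymptotic) competitive ratio of $\mathcal S$ is the infimum of all $R$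 for which $\mathcal S$ is $R$-competitive, and its absolute competitive ratio is the infimum of all $R$ for which this inequality holds for every $G$ with $\beta=0$ (an infimum over the empty set is $+\infty$). Theorem. For every deterministic online strategy $\mathcal S$ for MaxCC, both the asymptotic competitive ratio and the absolute competitive ratio of $\mathcal S$ are at least $6$. -/

import Mathlib

namespace MaxCC

open Finset

/-- A clustering of the vertices `0, …, n - 1` (listed in order of arrival): a partition of the
vertex set into nonempty clusters. -/
abbrev Clustering (n : ℕ) : Type := Finpartition (univ : Finset (Fin n))

/-- Every cluster induces a clique of `G`. -/
def IsCliqueClustering {n : ℕ} (G : SimpleGraph (Fin n)) (P : Clustering n) : Prop :=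
  ∀ C ∈ P.parts, G.IsClique (C : Set (Fin n))

/-- The profit of a clustering: the sum of `|C| choose 2` over its clusters `C`. -/
def profit {n : ℕ} (P : Clustering n) : ℕ :=
  ∑ C ∈ P.parts, C.card.choose 2

open Classical in
/-- The optimal profit: the maximum profit of a clustering of `G` into cliques. -/
noncomputable def profitOpt {n : ℕ} (G : SimpleGraph (Fin n)) : ℕ :=
  (univ.filter fun P : Clustering n => IsCliqueClustering G P).sup profit

/-- The part of the input that was known before the last vertex arrived: the subgraph of `G`
induced by all its vertices except the last one. -/
def prefixGraph {n : ℕ} (G : SimpleGraph (Fin (n + 1))) : SimpleGraph (Fin n) :=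
  G.comap Fin.castSucc

/-- A deterministic online strategy. `cluster G` is the clustering held after the vertices of `G`
have arrived, when nothing but `G` (the subgraph induced by the vertices that have arrived so far)
is known. It is always a clustering into cliques. When a vertex arrives, a singleton cluster is
created for it and then any number of clusters may be merged; so each of the previous clusters has
to be contained in one of the new clusters, and this is the only restriction, since every subset
of a clique is a clique. -/
structure OnlineStrategy where
  cluster : {n : ℕ} → SimpleGraph (Fin n) → Clustering n
  isClique : ∀ {n : ℕ} (G : SimpleGraph (Fin n)), IsCliqueClustering G (cluster G)
  irrevocable : ∀ {n : ℕ} (G : SimpleGraph (Fin (n + 1))),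
    ∀ C ∈ (cluster (prefixGraph G)).parts, ∃ C' ∈ (cluster G).parts,
      C.map Fin.castSuccEmb ⊆ C'

/-- `R * profit_S(G) + β ≥ profit_OPT(G)` for every input graph `G`. -/
def OnlineStrategy.CompetitiveWith (S : OnlineStrategy) (R β : ℝ) : Prop :=
  ∀ (n : ℕ) (G : SimpleGraph (Fin n)),
    R * (profit (S.cluster G) : ℝ) + β ≥ (profitOpt G : ℝ)

/-- `S` is `R`-competitive: there is an additive constant that serves all input graphs. -/
def OnlineStrategy.IsCompetitive (S : OnlineStrategy) (R : ℝ) : Prop :=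
  ∃ β : ℝ, S.CompetitiveWith R β

/-- The (asymptotic) competitive ratio: the infimum of all `R` such that `S` is `R`-competitive
(`⊤` if there are none). -/
noncomputable def OnlineStrategy.competitiveRatio (S : OnlineStrategy) : EReal :=
  sInf ((fun R : ℝ => (R : EReal)) '' {R : ℝ | S.IsCompetitive R})

/-- The absolute competitive ratio: the infimum of all `R` such that `S` is `R`-competitive with
additive constant `0` (`⊤` if there are none). -/
noncomputable def OnlineStrategy.absoluteCompetitiveRatio (S : OnlineStrategy) : EReal :=
  sInf ((fun R : ℝ => (R : EReal)) '' {R : ℝ | S.CompetitiveWith R 0})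

end MaxCC

/-!
The adversary reveals many disjoint copies of a finite binary tree in which two vertices are
adjacent if one is an ancestor of the other or if they are siblings (`treeGraph`). The two children
of a vertex are revealed only after the strategy `S` has merged this vertex with its sibling. A
vertex that has a descendant therefore shares its cluster with a vertex that is not adjacent to the
descendant, so `S` can never merge anything but pairs of siblings
(`MaxCC.OnlineStrategy.Legal.joined_of_together`), and its profit is the number of merged pairs. It
does not matter when `S` merges a pair. The tree is finite, so the adversary can always reach a
moment at which every vertex has been revealed that should be
(`MaxCC.OnlineStrategy.Legal.exists_complete`), and only this moment is looked at.

The optimum can use cliques that run down the branches of the tree. If the tree were infinite, every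
branch would end in a pair of unmerged siblings, both of which can be added to a clique with `j`
further vertices. At each merged pair the clique that comes from above is prolonged by one sibling,
and the other sibling begins a new clique. Every merged pair thus contributes two vertices, so the
numbers `j` add up to twice the number of merged pairs, and
`(j + 2).choose 2 ≥ 3 * j` makes the profit at least six times the number of merged pairs.

In order to end the tree, some of its vertices, the leaves of a `Plan`, receive just one child,
which costs some profit. This is compensated by a surplus: if a pair is merged at which cliques of
average size `e` arrive, then the profit exceeds the required one by `e - 1`. Which of the two
siblings prolongs the clique can be decided afterwards, knowing all merges, and the best decision is
at least as good as any random one. With random decisions only the average size of the arriving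
cliques matters; this is the relation `Plan.Costs`, justified by `Plan.Costs.exists_packing`. A
finite plan whose surplus pays for all its leaves at any moment is given in
`Plan.exists_costs_one_zero`.

So in every copy the optimum is at least six times the profit of `S`, and it is at least `1` even if
`S` merges nothing (`Plan.exists_forces_six`). For `R < 6`, every copy adds a fixed positive amount
to the difference of the optimum and `R` times the profit of `S`, and the number of copies is
arbitrary; so no additive constant suffices.
-/

/-! ### Clique packings -/

/-- `CliquePacking G X m`: the finite vertex set `X` can be partitioned into cliques of `G` (some
of them possibly empty) with total profit `m`. -/
inductive CliquePacking {V : Type*} [DecidableEq V] (G : SimpleGraph V) : Finset V → ℕ → Prop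
  | empty : CliquePacking G ∅ 0
  | insert {X C : Finset V} {m : ℕ} (hX : CliquePacking G X m) (hC : G.IsClique (C : Set V))
      (hd : Disjoint C X) : CliquePacking G (C ∪ X) (C.card.choose 2 + m)

namespace CliquePacking

variable {V W : Type*} [DecidableEq V] [DecidableEq W] {G : SimpleGraph V} {H : SimpleGraph W}

theorem of_isClique {C : Finset V} (hC : G.IsClique (C : Set V)) :
    CliquePacking G C (C.card.choose 2) := by
  simpa using CliquePacking.insert CliquePacking.empty hC (Finset.disjoint_empty_right C)

theorem union {X Y : Finset V} {m k : ℕ} (hX : CliquePacking G X m) (hY : CliquePacking G Y k)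
    (hd : Disjoint X Y) : CliquePacking G (X ∪ Y) (m + k) := by
  induction hX with
  | empty => simpa using hY
  | @insert X C m hX hC hCX ih =>
    rw [Finset.disjoint_union_left] at hd
    rw [Finset.union_assoc, add_assoc]
    exact (ih hd.2).insert hC (Finset.disjoint_union_right.2 ⟨hCX, hd.1⟩)

theorem superset {X Y : Finset V} {m : ℕ} (hX : CliquePacking G X m) (h : X ⊆ Y) :
    CliquePacking G Y m := by
  have key : ∀ Z : Finset V, Disjoint X Z → CliquePacking G (X ∪ Z) m := by
    intro Z
    induction Z using Finset.induction_on with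
    | empty => intro _; simpa using hX
    | insert z Z hz ih =>
      intro hd
      rw [Finset.disjoint_insert_right] at hd
      have := (ih hd.2).insert (C := {z}) (by simp) (by simp [hd.1, hz])
      rw [Finset.union_insert, Finset.insert_eq]
      simpa using this
  simpa [Finset.union_sdiff_of_subset h] using key (Y \ X) Finset.disjoint_sdiff

theorem map {X : Finset V} {m : ℕ} (hX : CliquePacking G X m) (f : G ↪g H) :
    CliquePacking H (X.map f.toEmbedding) m := by
  induction hX with
  | empty => simpa using CliquePacking.empty
  | @insert X C m hX hC hCX ih =>
    rw [Finset.map_union, ← Finset.card_map f.toEmbedding (s := C)]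
    refine ih.insert ?_ ((Finset.disjoint_map _).2 hCX)
    rw [Finset.coe_map]
    rintro _ ⟨x, hx, rfl⟩ _ ⟨y, hy, rfl⟩ hxy
    exact f.map_adj_iff.2 (hC hx hy fun h => hxy (h ▸ rfl))

theorem comap {X : Finset V} {m : ℕ} (hX : CliquePacking G X m) {f : W → V}
    (hf : Function.Injective f) (hr : ↑X ⊆ Set.range f) :
    CliquePacking (G.comap f) (X.preimage f hf.injOn) m := by
  classical
  induction hX with
  | empty => simpa using CliquePacking.empty
  | @insert X C m hX hC hCX ih =>
    rw [Finset.coe_union, Set.union_subset_iff] at hr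
    have hcard : (C.preimage f hf.injOn).card = C.card := by
      rw [← Finset.card_image_of_injective _ hf, Finset.image_preimage,
        Finset.filter_true_of_mem fun x hx => hr.1 hx]
    rw [Finset.preimage_union, ← hcard]
    refine (ih hr.2).insert ?_ ?_
    · intro u hu v hv huv
      exact hC (Finset.mem_preimage.1 (Finset.mem_coe.1 hu))
        (Finset.mem_preimage.1 (Finset.mem_coe.1 hv)) (hf.ne huv)
    · rw [Finset.disjoint_left] at hCX ⊢
      intro u hu hu'
      exact hCX (Finset.mem_preimage.1 hu) (Finset.mem_preimage.1 hu')

theorem biUnion {ι : Type*} [DecidableEq ι] (s : Finset ι) (X : ι → Finset V) (m : ι → ℕ)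
    (h : ∀ i ∈ s, CliquePacking G (X i) (m i))
    (hd : (s : Set ι).PairwiseDisjoint X) :
    CliquePacking G (s.biUnion X) (∑ i ∈ s, m i) := by
  induction s using Finset.induction_on with
  | empty => simpa using CliquePacking.empty
  | insert i s hi ih =>
    rw [Finset.biUnion_insert, Finset.sum_insert hi]
    refine (h i (by simp)).union (ih (fun j hj => h j (by simp [hj]))
      (hd.subset (by simp))) ?_
    rw [Finset.disjoint_biUnion_right]
    intro j hj
    exact hd (by simp) (by simp [hj]) (fun hij => hi (hij ▸ hj))

theorem exists_finpartition {X : Finset V} {m : ℕ} (hX : CliquePacking G X m) :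
    ∃ P : Finpartition X, (∀ C ∈ P.parts, G.IsClique (C : Set V)) ∧
      ∑ C ∈ P.parts, C.card.choose 2 = m := by
  induction hX with
  | empty => exact ⟨Finpartition.empty _, by simp⟩
  | @insert X C m hX hC hCX ih =>
    obtain ⟨P, hP, hm⟩ := ih
    rcases C.eq_empty_or_nonempty with rfl | hne
    · refine ⟨P.copy (by simp), by simpa using hP, by simpa using hm⟩
    · have hCP : C ∉ P.parts := fun h =>
        hne.ne_empty (Finset.disjoint_self_iff_empty C |>.1 (hCX.mono_right (P.le h)))
      refine ⟨P.extend hne.ne_empty hCX.symm (by rw [Finset.sup_eq_union, Finset.union_comm]),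
        ?_, ?_⟩
      · simpa using ⟨hC, hP⟩
      · simp [Finset.sum_insert hCP, hm]

theorem le_profitOpt {n : ℕ} {G : SimpleGraph (Fin n)} {X : Finset (Fin n)} {m : ℕ}
    (hX : CliquePacking G X m) : m ≤ MaxCC.profitOpt G := by
  classical
  obtain ⟨P, hP, hm⟩ := (hX.superset (Finset.subset_univ X)).exists_finpartition
  have : MaxCC.profit P ≤ MaxCC.profitOpt G :=
    Finset.le_sup (f := MaxCC.profit) (Finset.mem_filter.2 ⟨Finset.mem_univ P, hP⟩)
  exact hm ▸ this

end CliquePacking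

/-! ### The binary tree of vertices -/

/-- The graph underlying one copy of the input. Vertices are the nodes of the infinite binary tree,
a node being the list of turns on the path that leads to it, the last turn first. Two nodes are
adjacent if one is an ancestor of the other or if they are siblings. -/
def treeGraph : SimpleGraph (List Bool) where
  Adj w w' := w ≠ w' ∧ (w <:+ w' ∨ w' <:+ w ∨ w.tail = w'.tail)
  symm := ⟨fun _ _ h => ⟨h.1.symm, by rcases h.2 with h | h | h <;> simp [h]⟩⟩
  loopless := ⟨fun _ h => h.1 rfl⟩

/-- The shape of the finite tree that is revealed in one copy. A vertex carrying `node l r` receives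
two children, which carry `l` and `r`; a vertex carrying `leaf` receives a single child. -/
inductive Plan
  | leaf
  | node (l r : Plan)

namespace Plan

open Classical in
/-- The vertices revealed below the vertex `p` with plan `T`, if `J q` says that the two children of
`q` have been merged: the children of `p` are revealed, and those of its children provided that
these have been merged. -/
noncomputable def verts (J : List Bool → Prop) : Plan → List Bool → Finset (List Bool)
  | leaf, p => {false :: p}
  | node l r, p => {false :: p, true :: p} ∪
      if J p then verts J l (false :: p) ∪ verts J r (true :: p) else ∅

open Classical in
/-- The number of merged pairs of siblings below the vertex `p` with plan `T`. -/
noncomputable def merges (J : List Bool → Prop) : Plan → List Bool → ℕ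
  | leaf, _ => 0
  | node l r, p => if J p then 1 + merges J l (false :: p) + merges J r (true :: p) else 0

theorem exists_cons_suffix_of_mem_verts {J : List Bool → Prop} {T : Plan} {p w : List Bool}
    (h : w ∈ T.verts J p) : ∃ b, b :: p <:+ w := by
  induction T generalizing p with
  | leaf =>
    rw [verts, Finset.mem_singleton] at h
    exact ⟨false, by simp [h]⟩
  | node l r ihl ihr =>
    rw [verts, Finset.mem_union, Finset.mem_insert, Finset.mem_singleton] at h
    rcases h with (rfl | rfl) | h
    · exact ⟨false, List.suffix_rfl⟩
    · exact ⟨true, List.suffix_rfl⟩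
    · split_ifs at h
      · rcases Finset.mem_union.1 h with h | h
        · obtain ⟨b, hb⟩ := ihl h
          exact ⟨false, (List.suffix_cons b _).trans hb⟩
        · obtain ⟨b, hb⟩ := ihr h
          exact ⟨true, (List.suffix_cons b _).trans hb⟩
      · simp at h

/-- `T.Costs e κ`: if the cliques that arrive at a vertex with plan `T` have `e` vertices on average,
then at most `κ` is lost below that vertex. The loss is measured against a benchmark: the profit
`(j + 2).choose 2` of prolonging a clique of size `j` by two children, plus `6` for every pair that
is merged below the vertex.

A leaf provides only one child, so that `j + 1` is lost. When the pair at a `node` is merged, the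
arriving clique is prolonged into the left subtree with weight `q` and into the right subtree with
weight `1 - q`, while a new clique is begun in the other one: this changes the average sizes to
`1 + q * e` and `1 + (1 - q) * e`, and the sum of the two new profits
`(j + 3).choose 2 + Nat.choose 3 2` exceeds the benchmark `(j + 2).choose 2 + 6` by `j - 1`. -/
inductive Costs : Plan → ℝ → ℝ → Prop
  | leaf (e : ℝ) : Costs leaf e (e + 1)
  | node {l r : Plan} {e a b κ : ℝ} (q : ℝ) (hq : 0 ≤ q) (hq' : q ≤ 1)
      (hl : Costs l (1 + q * e) a) (hr : Costs r (1 + (1 - q) * e) b) (hκ : 0 ≤ κ)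
      (h : a + b - (e - 1) ≤ κ) : Costs (node l r) e κ

theorem isClique_of_suffix {A : Finset (List Bool)} {p : List Bool} (h : ∀ w ∈ A, w <:+ p) :
    treeGraph.IsClique (A : Set (List Bool)) := by
  intro u hu v hv huv
  refine ⟨huv, ?_⟩
  rcases List.suffix_or_suffix_of_suffix (h u hu) (h v hv) with h | h <;> simp [h]

theorem not_cons_suffix {p w : List Bool} (b : Bool) (h : w <:+ p) : ¬ b :: p <:+ w := fun h' => by
  have := (h'.trans h).length_le
  simp at this

theorem cons_suffix_inj {b c : Bool} {p w : List Bool} (h : b :: p <:+ w) (h' : c :: p <:+ w) :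
    b = c := by
  rcases List.suffix_or_suffix_of_suffix h h' with h | h
  · simpa using h.eq_of_length (by simp)
  · simpa using (h.eq_of_length (by simp)).symm

/-- Prolong the clique `A` into the subtree of one child `b :: p` of `p`, and begin a new clique in
the subtree of the other child. -/
theorem packing_prolong {J : List Bool → Prop} {T T' : Plan} {p : List Bool}
    {A : Finset (List Bool)} (hA : ∀ w ∈ A, w <:+ p) {b c : Bool} (hbc : b ≠ c) {m m' : ℕ}
    (h : CliquePacking treeGraph (insert (b :: p) A ∪ T.verts J (b :: p)) m)
    (h' : CliquePacking treeGraph ({c :: p} ∪ T'.verts J (c :: p)) m') :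
    CliquePacking treeGraph (A ∪ ({b :: p, c :: p} ∪
      (T.verts J (b :: p) ∪ T'.verts J (c :: p)))) (m + m') := by
  have key := h.union h' ?_
  · convert key using 1
    ext w
    simp only [Finset.mem_union, Finset.mem_insert, Finset.mem_singleton]
    tauto
  · rw [Finset.disjoint_left]
    intro w hw hw'
    have h2 : c :: p <:+ w := by
      rcases Finset.mem_union.1 hw' with h | h
      · rw [Finset.mem_singleton.1 h]
      · obtain ⟨d, hd⟩ := exists_cons_suffix_of_mem_verts h
        exact (List.suffix_cons d _).trans hd
    rcases Finset.mem_union.1 hw with h | h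
    · rcases Finset.mem_insert.1 h with rfl | h
      · exact hbc (cons_suffix_inj List.suffix_rfl h2)
      · exact not_cons_suffix c (hA w h) h2
    · obtain ⟨d, hd⟩ := exists_cons_suffix_of_mem_verts h
      exact hbc (cons_suffix_inj ((List.suffix_cons d _).trans hd) h2)

theorem cast_choose_two_succ (j : ℕ) :
    (((j + 1).choose 2 : ℕ) : ℝ) = (j.choose 2 : ℕ) + j := by
  rw [Nat.choose_succ_succ' j 1]
  push_cast [Nat.choose_one_right]
  ring

/-- The loss below a vertex is bounded by an affine function of the size of the clique that arrives
there. The function depends on the outcome `J`, but since it is affine, its average over several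
cliques is its value at their average size. -/
theorem Costs.exists_packing {T : Plan} {e κ : ℝ} (hT : T.Costs e κ) (J : List Bool → Prop)
    (p : List Bool) : ∃ α β : ℝ, α + β * e ≤ κ ∧
      ∀ A : Finset (List Bool), (∀ w ∈ A, w <:+ p) →
        ∃ m : ℕ, CliquePacking treeGraph (A ∪ T.verts J p) m ∧
          6 * (T.merges J p : ℝ) + ((A.card + 2).choose 2 : ℕ) - (α + β * A.card) ≤ m := by
  induction hT generalizing p with
  | leaf e =>
    refine ⟨1, 1, by linarith, fun A hA => ⟨_, CliquePacking.of_isClique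
      (isClique_of_suffix (p := false :: p) ?_), ?_⟩⟩
    · intro w hw
      rcases Finset.mem_union.1 hw with h | h
      · exact (hA w h).trans (List.suffix_cons _ _)
      · rw [verts, Finset.mem_singleton] at h
        rw [h]
    · have hn : false :: p ∉ A := fun h => not_cons_suffix _ (hA _ h) List.suffix_rfl
      rw [verts, Finset.union_comm, ← Finset.insert_eq, Finset.card_insert_of_notMem hn, merges,
        cast_choose_two_succ (A.card + 1)]
      push_cast
      linarith
  | @node l r e a b κ q hq hq' hl hr hκ hab ihl ihr =>
    by_cases hJ : J p
    · obtain ⟨αl, βl, hle, hlA⟩ := ihl (false :: p)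
      obtain ⟨αr, βr, hre, hrA⟩ := ihr (true :: p)
      refine ⟨αl + βl + αr + βr + 1, q * βl + (1 - q) * βr - 1, by nlinarith, fun A hA => ?_⟩
      have hn : ∀ b, b :: p ∉ A := fun b h => not_cons_suffix _ (hA _ h) List.suffix_rfl
      have hins : ∀ b, ∀ w ∈ insert (b :: p) A, w <:+ b :: p := by
        intro b w hw
        rcases Finset.mem_insert.1 hw with rfl | h
        · exact List.suffix_rfl
        · exact (hA w h).trans (List.suffix_cons _ _)
      have hone : ∀ b, ∀ w ∈ ({b :: p} : Finset (List Bool)), w <:+ b :: p := by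
        intro b w hw
        rw [Finset.mem_singleton.1 hw]
      obtain ⟨m₁, h₁, hm₁⟩ := hlA _ (hins false)
      obtain ⟨m₂, h₂, hm₂⟩ := hrA _ (hone true)
      obtain ⟨m₃, h₃, hm₃⟩ := hlA _ (hone false)
      obtain ⟨m₄, h₄, hm₄⟩ := hrA _ (hins true)
      rw [Finset.card_insert_of_notMem (hn _), add_right_comm, cast_choose_two_succ] at hm₁ hm₄
      rw [Finset.card_singleton] at hm₂ hm₃
      have hc : ((1 + 2).choose 2 : ℕ) = 3 := rfl
      rw [hc] at hm₂ hm₃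
      push_cast at hm₁ hm₂ hm₃ hm₄
      have hv : (Plan.node l r).verts J p = {false :: p, true :: p} ∪
          (l.verts J (false :: p) ∪ r.verts J (true :: p)) := by rw [verts, if_pos hJ]
      have hmg : (Plan.node l r).merges J p =
          1 + l.merges J (false :: p) + r.merges J (true :: p) := by rw [merges, if_pos hJ]
      rw [hv, hmg]
      push_cast
      have hP₁ := packing_prolong hA (by decide) h₁ h₂
      have hP₂ := packing_prolong hA (by decide) h₄ h₃
      rw [Finset.pair_comm, Finset.union_comm (r.verts _ _)] at hP₂
      -- The better of the two ways of prolonging `A` is at least as good as their average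
      -- with weights `q` and `1 - q`.
      by_contra! hcon
      have c₁ := hcon _ hP₁
      have c₂ := hcon _ hP₂
      push_cast at c₁ c₂
      rcases hq.eq_or_lt with rfl | hq
      · linarith
      · nlinarith [mul_lt_mul_of_pos_left c₁ hq,
          mul_le_mul_of_nonneg_left c₂.le (sub_nonneg.2 hq')]
    · refine ⟨0, 0, by simpa using hκ, fun A hA => ⟨_, CliquePacking.of_isClique ?_, ?_⟩⟩
      · intro u hu v hv huv
        rw [verts, if_neg hJ, Finset.union_empty, Finset.mem_coe, Finset.mem_union,
          Finset.mem_insert, Finset.mem_singleton] at hu hv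
        refine ⟨huv, ?_⟩
        rcases hu with hu | rfl | rfl <;> rcases hv with hv | rfl | rfl
        · exact (isClique_of_suffix hA hu hv huv).2
        · exact Or.inl ((hA u hu).trans (List.suffix_cons _ _))
        · exact Or.inl ((hA u hu).trans (List.suffix_cons _ _))
        · exact Or.inr (Or.inl ((hA v hv).trans (List.suffix_cons _ _)))
        · simp
        · simp
        · exact Or.inr (Or.inl ((hA v hv).trans (List.suffix_cons _ _)))
        · simp
        · simp
      · have hd : Disjoint A {false :: p, true :: p} := by
          rw [Finset.disjoint_left]
          intro w hw hw'
          rw [Finset.mem_insert, Finset.mem_singleton] at hw'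
          rcases hw' with rfl | rfl <;> exact not_cons_suffix _ (hA _ hw) List.suffix_rfl
        rw [verts, if_neg hJ, Finset.union_empty, Finset.card_union_of_disjoint hd,
          Finset.card_pair (by simp), merges, if_neg hJ]
        simp

/-- A tail of length `n`: of each merged pair only the left child receives a pair of children in
its turn. -/
def tail : ℕ → Plan
  | 0 => leaf
  | n + 1 => node (tail n) leaf

theorem Costs.tail_succ {n : ℕ} {e a κ : ℝ} (h : (tail n).Costs (e + 1) a) (hκ : 0 ≤ κ)
    (hc : a + 3 - e ≤ κ) : (tail (n + 1)).Costs e κ :=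
  .node 1 (by norm_num) (by norm_num) (by convert h using 1; ring) (.leaf _) hκ (by linarith)

theorem costs_tail_six {e : ℝ} (h2 : 2 ≤ e) (h3 : e ≤ 3) : (tail 6).Costs e (3 - e) := by
  have h₀ : (tail 0).Costs (e + 6) (e + 6 + 1) := .leaf _
  have h₁ : (tail 1).Costs (e + 5) 5 :=
    .tail_succ (by convert h₀ using 1; ring) (by norm_num) (by linarith)
  have h₂ : (tail 2).Costs (e + 4) (4 - e) :=
    .tail_succ (by convert h₁ using 1; ring) (by linarith) (by linarith)
  have h₃ : (tail 3).Costs (e + 3) 0 :=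
    .tail_succ (by convert h₂ using 1; ring) le_rfl (by linarith)
  have h₄ : (tail 4).Costs (e + 2) 0 :=
    .tail_succ (by convert h₃ using 1; ring) le_rfl (by linarith)
  have h₅ : (tail 5).Costs (e + 1) 0 :=
    .tail_succ (by convert h₄ using 1; ring) le_rfl (by linarith)
  exact .tail_succ h₅ (by linarith) (by linarith)

/-- A finite plan that loses nothing when single vertices arrive at it. It is built from its ends
towards its root. Tails are cheap only where the arriving cliques have average size at least `2`, so
the decisions are biased until size `5 / 2` is reached on one side; the unbiased steps nearer to the
root, and the repeated steps at size `3 / 2`, earn what the tails cost. -/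
theorem exists_costs_one_zero : ∃ T : Plan, T.Costs 1 0 := by
  have h2 : (tail 6).Costs 2 1 := by
    convert costs_tail_six (e := 2) (by norm_num) (by norm_num) using 1
    norm_num
  have h52 : (tail 6).Costs (5 / 2) (1 / 2) := by
    convert costs_tail_six (e := 5 / 2) (by norm_num) (by norm_num) using 1
    norm_num
  obtain ⟨A, hA⟩ : ∃ A : Plan, A.Costs (5 / 2) 0 :=
    ⟨_, .node (3 / 5) (by norm_num) (by norm_num) (by convert h52 using 1; norm_num)
      (by convert h2 using 1; norm_num) (by norm_num) (by norm_num)⟩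
  obtain ⟨B, hB⟩ : ∃ B : Plan, B.Costs (3 / 2) (3 / 2) :=
    ⟨_, .node 1 (by norm_num) (by norm_num) (by convert hA using 1; norm_num)
      (.leaf _) (by norm_num) (by norm_num)⟩
  obtain ⟨C, hC⟩ : ∃ C : Plan, C.Costs 2 (1 / 2) :=
    ⟨_, .node (3 / 4) (by norm_num) (by norm_num) (by convert hA using 1; norm_num)
      (by convert hB using 1; norm_num) (by norm_num) (by norm_num)⟩
  obtain ⟨D, hD⟩ : ∃ D : Plan, D.Costs 2 0 :=
    ⟨_, .node (1 / 2) (by norm_num) (by norm_num) (by convert hC using 1; norm_num)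
      (by convert hC using 1; norm_num) (by norm_num) (by norm_num)⟩
  -- Pairing with `D` lowers the loss at `3 / 2` in steps of `1 / 2`.
  have step : ∀ a : ℝ, 1 / 2 ≤ a → (∃ E : Plan, E.Costs (3 / 2) a) →
      ∃ E : Plan, E.Costs (3 / 2) (a - 1 / 2) := by
    rintro a ha ⟨E, hE⟩
    exact ⟨_, .node (2 / 3) (by norm_num) (by norm_num) (by convert hD using 1; norm_num)
      (by convert hE using 1; norm_num) (by linarith) (by linarith)⟩
  obtain ⟨E, hE⟩ := step _ (by norm_num) (step _ (by norm_num) (step _ (by norm_num) ⟨B, hB⟩))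
  exact ⟨_, .node (1 / 2) (by norm_num) (by norm_num) (by convert hE using 1; norm_num)
    (by convert hE using 1; norm_num) le_rfl (by norm_num)⟩

/-- A plan for which the optimum of one copy is at least six times the number of merged pairs,
whatever the outcome `J` is. -/
theorem exists_forces_six : ∃ l r : Plan, ∀ J : List Bool → Prop,
    ∃ m : ℕ, CliquePacking treeGraph ((node l r).verts J []) m ∧
      6 * (node l r).merges J [] ≤ m ∧ 1 ≤ m := by
  obtain ⟨T, hT⟩ := exists_costs_one_zero
  refine ⟨T, T, fun J => ?_⟩
  by_cases hJ : J []
  · -- At the root the empty clique arrives; its benchmark `1` makes up for the loss of `1`.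
    have hroot : (node T T).Costs 0 1 := .node 0 le_rfl zero_le_one (by simpa using hT)
      (by simpa using hT) zero_le_one (by norm_num)
    obtain ⟨α, β, h, hA⟩ := hroot.exists_packing J []
    obtain ⟨m, hm, hle⟩ := hA ∅ (by simp)
    refine ⟨m, by simpa using hm, ?_⟩
    have h6 : 6 * (node T T).merges J [] ≤ m := by
      simp at hle h
      exact_mod_cast (by linarith : (6 * (node T T).merges J [] : ℝ) ≤ m)
    refine ⟨h6, ?_⟩
    rw [merges, if_pos hJ] at h6
    omega
  · refine ⟨_, CliquePacking.of_isClique ?_, ?_⟩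
    · intro u hu v hv huv
      simp only [verts, if_neg hJ, Finset.union_empty, Finset.coe_insert, Finset.coe_singleton,
        Set.mem_insert_iff, Set.mem_singleton_iff] at hu hv
      refine ⟨huv, Or.inr (Or.inr ?_)⟩
      rcases hu with rfl | rfl <;> rcases hv with rfl | rfl <;> rfl
    · simp [verts, merges, if_neg hJ]

/-- The plan carried by the vertex `p` if the root `[]` carries `P`. -/
def sub (P : Plan) : List Bool → Plan
  | [] => P
  | b :: p =>
    match sub P p with
    | leaf => leaf
    | node l r => if b then r else l

/-- The largest number of nodes on a path from the root. -/
def height : Plan → ℕ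
  | leaf => 0
  | node l r => max l.height r.height + 1

theorem height_sub_cons {P : Plan} {p : List Bool} (b : Bool) (h : P.sub p ≠ leaf) :
    (P.sub (b :: p)).height + 1 ≤ (P.sub p).height := by
  rw [sub]
  cases hp : P.sub p with
  | leaf => exact absurd hp h
  | node l r => cases b <;> simp [height]

open Classical in
/-- The vertices whose two children have been merged, below the vertex `p` with plan `T`. -/
noncomputable def mergedNodes (J : List Bool → Prop) : Plan → List Bool → Finset (List Bool)
  | leaf, _ => ∅
  | node l r, p =>
    if J p then insert p (mergedNodes J l (false :: p) ∪ mergedNodes J r (true :: p)) else ∅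

theorem card_mergedNodes_le (J : List Bool → Prop) (T : Plan) (p : List Bool) :
    (T.mergedNodes J p).card ≤ T.merges J p := by
  induction T generalizing p with
  | leaf => simp [mergedNodes]
  | node l r ihl ihr =>
    rw [mergedNodes, merges]
    split_ifs
    · have h₁ := Finset.card_insert_le p (l.mergedNodes J (false :: p) ∪ r.mergedNodes J (true :: p))
      have h₂ := Finset.card_union_le (l.mergedNodes J (false :: p)) (r.mergedNodes J (true :: p))
      have := ihl (false :: p)
      have := ihr (true :: p)
      omega
    · simp

/-- If pairs are merged only below merged pairs, all of them are among `mergedNodes`. -/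
theorem mem_mergedNodes {J : List Bool → Prop} {P : Plan}
    (hJ : ∀ b p, J (b :: p) → J p) (hsub : ∀ p, J p → P.sub p ≠ leaf) {p : List Bool} (hp : J p) :
    p ∈ P.mergedNodes J [] := by
  have key : ∀ q, J q → (P.sub q).mergedNodes J q ⊆ P.mergedNodes J [] := by
    intro q
    induction q with
    | nil => intro _; exact subset_rfl
    | cons b q ih =>
      intro hq
      have hq' := hJ b q hq
      refine subset_trans ?_ (ih hq')
      rw [sub]
      cases hs : P.sub q with
      | leaf => exact absurd hs (hsub q hq')
      | node l r =>
        rw [mergedNodes, if_pos hq']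
        intro w hw
        cases b <;> simp at hw <;> simp [hw]
  refine key p hp ?_
  cases hs : P.sub p with
  | leaf => exact absurd hs (hsub p hp)
  | node l r => simp [mergedNodes, if_pos hp]

end Plan

/-! ### The adversary -/

/-- Infinitely many disjoint copies of `treeGraph`. -/
def forestGraph : SimpleGraph (ℕ × List Bool) where
  Adj u v := u.1 = v.1 ∧ treeGraph.Adj u.2 v.2
  symm := ⟨fun _ _ h => ⟨h.1.symm, h.2.symm⟩⟩
  loopless := ⟨fun u h => treeGraph.loopless.irrefl u.2 h.2⟩

/-- The graph in which the `k`-th vertex to arrive is the vertex `a k` of the forest. -/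
def inputGraph (a : ℕ → ℕ × List Bool) (n : ℕ) : SimpleGraph (Fin n) :=
  forestGraph.comap fun k => a k

namespace MaxCC.OnlineStrategy

variable (S : OnlineStrategy)

/-- After `n` arrivals, the vertices `u` and `v` of the forest lie in the same cluster of `S`. -/
def Together (a : ℕ → ℕ × List Bool) (n : ℕ) (u v : ℕ × List Bool) : Prop :=
  ∃ C ∈ (S.cluster (inputGraph a n)).parts, ∃ j ∈ C, ∃ k ∈ C, a j = u ∧ a k = v

/-- After `n` arrivals, `S` has merged the two children of the vertex `p` of the copy `i`. -/
def Joined (a : ℕ → ℕ × List Bool) (n i : ℕ) (p : List Bool) : Prop :=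
  S.Together a n (i, false :: p) (i, true :: p)

/-- The vertices that the adversary wants to reveal, in `N` copies with plan `P`: the children of
the roots `[]`, which are not vertices of the input themselves, and of those vertices that have been
merged with their siblings. A vertex with plan `leaf` receives only its left child `false :: p`. -/
def Demanded (N : ℕ) (P : Plan) (a : ℕ → ℕ × List Bool) (n : ℕ) : ℕ × List Bool → Prop
  | (_, []) => False
  | (i, b :: p) => i < N ∧ (p = [] ∨ S.Joined a n i p.tail) ∧ (b = true → P.sub p ≠ .leaf)

/-- The first `n` arrivals are distinct vertices that were demanded when they were revealed. -/
structure Legal (N : ℕ) (P : Plan) (a : ℕ → ℕ × List Bool) (n : ℕ) : Prop where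
  inj : ∀ j < n, ∀ k < n, a j = a k → j = k
  demanded : ∀ m < n, S.Demanded N P a m (a m)

variable {S} {N : ℕ} {P : Plan} {a : ℕ → ℕ × List Bool} {n : ℕ}

theorem Together.succ {u v : ℕ × List Bool} (h : S.Together a n u v) :
    S.Together a (n + 1) u v := by
  obtain ⟨C, hC, j, hj, k, hk, rfl, rfl⟩ := h
  obtain ⟨C', hC', hsub⟩ := S.irrevocable (inputGraph a (n + 1)) C hC
  exact ⟨C', hC', j.castSucc, hsub (Finset.mem_map_of_mem _ hj), k.castSucc,
    hsub (Finset.mem_map_of_mem _ hk), rfl, rfl⟩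

theorem Together.mono {u v : ℕ × List Bool} {m : ℕ} (h : S.Together a m u v) (hmn : m ≤ n) :
    S.Together a n u v := by
  induction n, hmn using Nat.le_induction with
  | base => exact h
  | succ n _ ih => exact ih.succ

theorem Together.symm {u v : ℕ × List Bool} (h : S.Together a n u v) : S.Together a n v u := by
  obtain ⟨C, hC, j, hj, k, hk, hu, hv⟩ := h
  exact ⟨C, hC, k, hk, j, hj, hv, hu⟩

theorem Together.exists_left {u v : ℕ × List Bool} (h : S.Together a n u v) :
    ∃ m < n, a m = u := by
  obtain ⟨C, hC, j, hj, k, hk, hu, hv⟩ := h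
  exact ⟨j, j.2, hu⟩

theorem Together.adj {u v : ℕ × List Bool} (h : S.Together a n u v) (huv : u ≠ v) :
    forestGraph.Adj u v := by
  obtain ⟨C, hC, j, hj, k, hk, rfl, rfl⟩ := h
  exact S.isClique _ C hC hj hk fun h => huv (h ▸ rfl)

theorem Together.trans {u v w : ℕ × List Bool} (hL : S.Legal N P a n) (h : S.Together a n u v)
    (h' : S.Together a n v w) : S.Together a n u w := by
  obtain ⟨C, hC, j, hj, k, hk, rfl, rfl⟩ := h
  obtain ⟨C', hC', j', hj', k', hk', hv, rfl⟩ := h'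
  obtain rfl : j' = k := Fin.ext (hL.inj _ j'.2 _ k.2 hv)
  obtain rfl : C = C' := (S.cluster _).disjoint.elim_finset hC hC' _ hk hj'
  exact ⟨C, hC, j, hj, k', hk', rfl, rfl⟩

theorem Demanded.mono {m : ℕ} {u : ℕ × List Bool} (h : S.Demanded N P a m u) (hmn : m ≤ n) :
    S.Demanded N P a n u := by
  obtain ⟨i, _ | ⟨b, p⟩⟩ := u
  · exact h.elim
  · exact ⟨h.1, h.2.1.imp_right fun h => Together.mono h hmn, h.2.2⟩

namespace Legal

theorem demanded_of_present (hL : S.Legal N P a n) {u : ℕ × List Bool} (hu : ∃ m < n, a m = u) :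
    S.Demanded N P a n u := by
  obtain ⟨m, hm, rfl⟩ := hu
  exact (hL.demanded m hm).mono hm.le

theorem present_of_joined {i : ℕ} {p : List Bool} (h : S.Joined a n i p) (b : Bool) :
    ∃ m < n, a m = (i, b :: p) := by
  cases b
  · exact Together.exists_left h
  · exact Together.exists_left (Together.symm h)

theorem joined_tail (hL : S.Legal N P a n) {i : ℕ} {b : Bool} {p : List Bool}
    (h : S.Joined a n i (b :: p)) : S.Joined a n i p := by
  have := (hL.demanded_of_present (present_of_joined h false)).2.1
  simpa using this

theorem sub_ne_leaf (hL : S.Legal N P a n) {i : ℕ} {p : List Bool} (h : S.Joined a n i p) :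
    P.sub p ≠ .leaf :=
  (hL.demanded_of_present (present_of_joined h true)).2.2 rfl

/-- Once a vertex has a descendant, it has been merged with its sibling. -/
theorem joined_of_cons_suffix (hL : S.Legal N P a n) {i : ℕ} {c b : Bool} {p w : List Bool}
    (h : c :: b :: p <:+ w) (hw : ∃ m < n, a m = (i, w)) : S.Joined a n i p := by
  induction w with
  | nil => simp at h
  | cons d w ih =>
    have hd := (hL.demanded_of_present hw).2.1
    rcases List.suffix_cons_iff.1 h with h | h
    · obtain ⟨rfl, rfl⟩ := List.cons_eq_cons.1 h
      simpa using hd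
    · rcases hd with rfl | hd
      · simp at h
      · cases w with
        | nil => simp at h
        | cons e w => exact ih h (present_of_joined hd e)

/-- A vertex is never clustered together with a descendant: by the time the descendant arrives,
the vertex shares its cluster with its sibling, which is not adjacent to the descendant. -/
theorem not_together_of_suffix (hL : S.Legal N P a n) {i : ℕ} {w w' : List Bool}
    (h : S.Together a n (i, w) (i, w')) (hne : w ≠ w') : ¬ w <:+ w' := by
  intro hs
  obtain ⟨t, rfl⟩ := hs
  rcases List.eq_nil_or_concat t with rfl | ⟨t, c, rfl⟩
  · simp at hne
  cases w with
  | nil => exact hL.demanded_of_present h.exists_left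
  | cons b p =>
    have hc : c :: b :: p <:+ t.concat c ++ b :: p := ⟨t, by simp⟩
    have hJ := hL.joined_of_cons_suffix hc h.symm.exists_left
    have hsib : S.Together a n (i, (!b) :: p) (i, b :: p) := by
      cases b
      · exact Together.symm hJ
      · exact hJ
    have hbp : b :: p <:+ t.concat c ++ b :: p := ⟨_, rfl⟩
    have hlen := hc.length_le
    have hadj := ((hsib.trans hL h).adj fun h => by
      have := congrArg List.length (Prod.ext_iff.1 h).2
      simp at this hlen
      omega).2.2
    rcases hadj with h | h | h
    · have := Plan.cons_suffix_inj h hbp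
      simp at this
    · have := hlen.trans h.length_le
      simp at this
    · have := congrArg List.length h
      simp at this hlen
      omega

/-- The only vertices that can share a cluster are siblings. -/
theorem joined_of_together (hL : S.Legal N P a n) {u v : ℕ × List Bool} (h : S.Together a n u v)
    (hne : u ≠ v) : ∃ i p, S.Joined a n i p ∧
      (u = (i, false :: p) ∧ v = (i, true :: p) ∨ u = (i, true :: p) ∧ v = (i, false :: p)) := by
  obtain ⟨i, w⟩ := u
  obtain ⟨i', w'⟩ := v
  obtain ⟨hi, hw, hadj⟩ := h.adj hne
  obtain rfl : i = i' := hi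
  replace hw : w ≠ w' := hw
  rcases hadj with hs | hs | hs
  · exact absurd hs (hL.not_together_of_suffix h hw)
  · exact absurd hs (hL.not_together_of_suffix h.symm hw.symm)
  · cases w with
    | nil => exact (hL.demanded_of_present h.exists_left).elim
    | cons b p =>
      cases w' with
      | nil => exact (hL.demanded_of_present h.symm.exists_left).elim
      | cons b' p' =>
        obtain rfl : p = p' := hs
        refine ⟨i, p, ?_⟩
        cases b <;> cases b'
        · simp at hw
        · exact ⟨h, by simp⟩
        · exact ⟨h.symm, by simp⟩
        · simp at hw

/-- The profit of `S` is at most the number of merged pairs of siblings. -/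
theorem profit_le (hL : S.Legal N P a n) :
    profit (S.cluster (inputGraph a n)) ≤
      ∑ i ∈ Finset.range N, P.merges (S.Joined a n i) [] := by
  classical
  have hdisj : ((S.cluster (inputGraph a n)).parts : Set (Finset (Fin n))).PairwiseDisjoint
      (Finset.powersetCard 2) := by
    intro C hC C' hC' hne
    refine Finset.disjoint_left.2 fun s hs hs' => hne ?_
    rw [Finset.mem_powersetCard] at hs hs'
    obtain ⟨j, hj⟩ : s.Nonempty := Finset.card_pos.1 (by omega)
    exact (S.cluster _).disjoint.elim_finset hC hC' j (hs.1 hj) (hs'.1 hj)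
  have hprofit : profit (S.cluster (inputGraph a n)) =
      ((S.cluster (inputGraph a n)).parts.biUnion (Finset.powersetCard 2)).card := by
    rw [Finset.card_biUnion hdisj]
    simp [profit]
  calc profit (S.cluster (inputGraph a n))
      ≤ ((Finset.range N).sigma fun i => P.mergedNodes (S.Joined a n i) []).card := by
        rw [hprofit]
        -- A merged pair is determined by its parent.
        have hparent : ∀ s : Finset (Fin n),
            s ∈ (S.cluster (inputGraph a n)).parts.biUnion (Finset.powersetCard 2) →
            ∃ x ∈ (Finset.range N).sigma fun i => P.mergedNodes (S.Joined a n i) [],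
              s = Finset.univ.filter fun j : Fin n => ∃ b, a j = (x.1, b :: x.2) := by
          intro s hs
          obtain ⟨C, hC, hs⟩ := Finset.mem_biUnion.1 hs
          obtain ⟨hsC, hcard⟩ := Finset.mem_powersetCard.1 hs
          obtain ⟨j, k, hjk, rfl⟩ := Finset.card_eq_two.1 hcard
          have ht : S.Together a n (a j) (a k) :=
            ⟨C, hC, j, hsC (by simp), k, hsC (by simp), rfl, rfl⟩
          obtain ⟨i, p, hJ, hp⟩ := hL.joined_of_together ht
            fun h => hjk (Fin.ext (hL.inj _ j.2 _ k.2 h))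
          refine ⟨⟨i, p⟩, Finset.mem_sigma.2 ⟨Finset.mem_range.2 ?_, ?_⟩, ?_⟩
          · exact (hL.demanded_of_present (present_of_joined hJ false)).1
          · exact Plan.mem_mergedNodes (J := S.Joined a n i) (fun b p h => hL.joined_tail h)
              (fun p h => hL.sub_ne_leaf h) hJ
          · have hinj : ∀ l l' : Fin n, a l = a l' → l = l' := fun l l' h =>
              Fin.ext (hL.inj _ l.2 _ l'.2 h)
            ext l
            simp only [Finset.mem_insert, Finset.mem_singleton, Finset.mem_filter,
              Finset.mem_univ, true_and, Bool.exists_bool]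
            constructor
            · rintro (rfl | rfl) <;> tauto
            · rintro (h | h) <;> rcases hp with hp | hp
              · exact Or.inl (hinj _ _ (h.trans hp.1.symm))
              · exact Or.inr (hinj _ _ (h.trans hp.2.symm))
              · exact Or.inr (hinj _ _ (h.trans hp.2.symm))
              · exact Or.inl (hinj _ _ (h.trans hp.1.symm))
        refine (Finset.card_le_card fun s hs => ?_).trans (Finset.card_image_le
          (f := fun x : (_ : ℕ) × List Bool =>
            Finset.univ.filter fun j : Fin n => ∃ b, a j = (x.1, b :: x.2)))
        obtain ⟨x, hx, rfl⟩ := hparent s hs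
        exact Finset.mem_image_of_mem _ hx
    _ = ∑ i ∈ Finset.range N, (P.mergedNodes (S.Joined a n i) []).card := Finset.card_sigma _ _
    _ ≤ _ := Finset.sum_le_sum fun i _ => Plan.card_mergedNodes_le _ _ _

/-- The depth at which vertices are revealed is bounded, because plans get smaller downwards. -/
theorem length_add_height_le (hL : S.Legal N P a n) {i : ℕ} {b : Bool} {p : List Bool}
    (h : ∃ m < n, a m = (i, b :: p)) : p.length + (P.sub p).height ≤ P.height := by
  induction p generalizing b with
  | nil => simp [Plan.sub]
  | cons c p ih =>
    have hJ : S.Joined a n i p := by simpa using (hL.demanded_of_present h).2.1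
    have h₁ := ih (present_of_joined hJ c)
    have h₂ := Plan.height_sub_cons c (hL.sub_ne_leaf hJ)
    rw [List.length_cons]
    omega

theorem exists_bound (S : OnlineStrategy) (N : ℕ) (P : Plan) :
    ∃ B, ∀ a n, S.Legal N P a n → n ≤ B := by
  have hfin : (Set.Iio N ×ˢ {w : List Bool | w.length ≤ P.height + 1}).Finite :=
    (Set.finite_Iio N).prod (List.finite_length_le Bool _)
  refine ⟨hfin.toFinset.card, fun a n hL => ?_⟩
  rw [← Finset.card_range n]
  refine Finset.card_le_card_of_injOn a (fun m hm => ?_) fun j hj k hk h =>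
    hL.inj j (by simpa using hj) k (by simpa using hk) h
  have hm' : m < n := by simpa using hm
  rw [Finset.mem_coe, Set.Finite.mem_toFinset]
  have hd := hL.demanded m hm'
  rcases ha : a m with ⟨i, _ | ⟨b, p⟩⟩
  · rw [ha] at hd
    exact hd.elim
  · rw [ha] at hd
    have := hL.length_add_height_le ⟨m, hm', ha⟩
    refine ⟨hd.1, ?_⟩
    simp
    omega

theorem inputGraph_congr {a a' : ℕ → ℕ × List Bool} {n : ℕ} (h : ∀ m < n, a m = a' m) :
    inputGraph a n = inputGraph a' n := by
  have : (fun k : Fin n => a k) = fun k : Fin n => a' k := funext fun k => h k k.2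
  rw [inputGraph, inputGraph, this]

theorem together_congr {a a' : ℕ → ℕ × List Bool} {n : ℕ} (h : ∀ m < n, a m = a' m)
    {u v : ℕ × List Bool} (ht : S.Together a n u v) : S.Together a' n u v := by
  obtain ⟨C, hC, j, hj, k, hk, hu, hv⟩ := ht
  rw [inputGraph_congr h] at hC
  exact ⟨C, hC, j, hj, k, hk, (h j j.2).symm.trans hu, (h k k.2).symm.trans hv⟩

theorem demanded_congr {a a' : ℕ → ℕ × List Bool} {n : ℕ} (h : ∀ m < n, a m = a' m)
    {u : ℕ × List Bool} (ht : S.Demanded N P a n u) : S.Demanded N P a' n u := by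
  obtain ⟨i, _ | ⟨b, p⟩⟩ := u
  · exact ht.elim
  · exact ⟨ht.1, ht.2.1.imp_right (together_congr h), ht.2.2⟩

theorem extend (hL : S.Legal N P a n) {u : ℕ × List Bool} (hu : S.Demanded N P a n u)
    (hnew : ¬ ∃ m < n, a m = u) : S.Legal N P (Function.update a n u) (n + 1) := by
  have hold : ∀ m < n, Function.update a n u m = a m := fun m hm =>
    Function.update_of_ne hm.ne _ _
  have hlast : Function.update a n u n = u := Function.update_self _ _ _
  push Not at hnew
  refine ⟨fun j hj k hk h => ?_, fun m hm => ?_⟩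
  · rcases Nat.lt_succ_iff_lt_or_eq.1 hj with hj | rfl <;>
      rcases Nat.lt_succ_iff_lt_or_eq.1 hk with hk | rfl
    · rw [hold j hj, hold k hk] at h
      exact hL.inj j hj k hk h
    · rw [hold j hj, hlast] at h
      exact absurd h (hnew j hj)
    · rw [hold k hk, hlast] at h
      exact absurd h.symm (hnew k hk)
    · rfl
  · rcases Nat.lt_succ_iff_lt_or_eq.1 hm with hm | rfl
    · rw [hold m hm]
      exact demanded_congr (fun l hl => (hold l (hl.trans hm)).symm) (hL.demanded m hm)
    · rw [hlast]
      exact demanded_congr (fun l hl => (hold l hl).symm) hu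

/-- Since only finitely many vertices can ever be demanded, the adversary can go on until every
demanded vertex has been revealed. -/
theorem exists_complete (S : OnlineStrategy) (N : ℕ) (P : Plan) :
    ∃ a n, S.Legal N P a n ∧ ∀ u, S.Demanded N P a n u → ∃ m < n, a m = u := by
  by_contra! hcon
  have key : ∀ n, ∃ a, S.Legal N P a n := by
    intro n
    induction n with
    | zero => exact ⟨fun _ => (0, []), by simp, by simp⟩
    | succ n ih =>
      obtain ⟨a, hL⟩ := ih
      obtain ⟨u, hu, hnew⟩ := hcon a n hL
      exact ⟨_, hL.extend hu (by push Not; exact hnew)⟩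
  obtain ⟨B, hB⟩ := exists_bound S N P
  obtain ⟨a, hL⟩ := key (B + 1)
  have := hB _ _ hL
  omega

end Legal

theorem present_of_mem_verts (hC : ∀ u, S.Demanded N P a n u → ∃ m < n, a m = u) {i : ℕ}
    (hi : i < N) {w : List Bool} (hw : w ∈ P.verts (S.Joined a n i) []) :
    ∃ m < n, a m = (i, w) := by
  have key : ∀ (T : Plan) (p : List Bool), P.sub p = T → (p = [] ∨ S.Joined a n i p.tail) →
      ∀ w ∈ T.verts (S.Joined a n i) p, ∃ m < n, a m = (i, w) := by
    intro T
    induction T with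
    | leaf =>
      intro p hp hpar w hw
      rw [Plan.verts, Finset.mem_singleton] at hw
      exact hC _ (hw ▸ ⟨hi, hpar, by simp⟩)
    | node l r ihl ihr =>
      intro p hp hpar w hw
      rw [Plan.verts, Finset.mem_union, Finset.mem_insert, Finset.mem_singleton] at hw
      rcases hw with (rfl | rfl) | hw
      · exact hC _ ⟨hi, hpar, by simp⟩
      · exact hC _ ⟨hi, hpar, by simp [hp]⟩
      · split_ifs at hw with hJ
        · rcases Finset.mem_union.1 hw with hw | hw
          · exact ihl _ (by simp [Plan.sub, hp]) (Or.inr (by simpa using hJ)) w hw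
          · exact ihr _ (by simp [Plan.sub, hp]) (Or.inr (by simpa using hJ)) w hw
        · simp at hw
  exact key P [] rfl (Or.inl rfl) w hw

/-- When every demanded vertex has been revealed, clique packings of the copies can be combined to a
clustering of the input. -/
theorem sum_le_profitOpt (hL : S.Legal N P a n)
    (hC : ∀ u, S.Demanded N P a n u → ∃ m < n, a m = u) (f : ℕ → ℕ)
    (hf : ∀ i < N, CliquePacking treeGraph (P.verts (S.Joined a n i) []) (f i)) :
    ∑ i ∈ Finset.range N, f i ≤ profitOpt (inputGraph a n) := by
  let φ (i : ℕ) : treeGraph ↪g forestGraph :=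
    { toFun := Prod.mk i
      inj' := Prod.mk_right_injective i
      map_rel_iff' := by simp [forestGraph] }
  have hpack := CliquePacking.biUnion (Finset.range N) _ f
    (fun i hi => (hf i (Finset.mem_range.1 hi)).map (φ i)) ?_
  · have hinj : Function.Injective fun k : Fin n => a k := fun j k h =>
      Fin.ext (hL.inj _ j.2 _ k.2 h)
    refine (hpack.comap hinj ?_).le_profitOpt
    intro u hu
    simp only [Finset.coe_biUnion, Set.mem_iUnion, Finset.mem_coe, Finset.mem_map,
      Finset.mem_range] at hu
    obtain ⟨i, hi, w, hw, rfl⟩ := hu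
    obtain ⟨m, hm, ha⟩ := present_of_mem_verts hC hi hw
    exact ⟨⟨m, hm⟩, ha⟩
  · intro i _ j _ hij
    refine Finset.disjoint_left.2 fun u hu hu' => hij ?_
    obtain ⟨w, _, rfl⟩ := Finset.mem_map.1 hu
    obtain ⟨w', _, h⟩ := Finset.mem_map.1 hu'
    exact (congrArg Prod.fst h).symm

theorem six_le_of_isCompetitive {R : ℝ} (hR : S.IsCompetitive R) : 6 ≤ R := by
  obtain ⟨β, hβ⟩ := hR
  by_contra! hlt
  -- The profit of `S` is only bounded from above, so `R` is replaced by a nonnegative factor.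
  set R' := max R 0
  have hR' : R' < 6 := max_lt hlt (by norm_num)
  set δ := min 1 (6 - R')
  have hδ : 0 < δ := lt_min one_pos (by linarith)
  obtain ⟨N, hN⟩ := exists_nat_gt (β / δ)
  obtain ⟨l, r, hlr⟩ := Plan.exists_forces_six
  obtain ⟨a, n, hL, hC⟩ := Legal.exists_complete S N (.node l r)
  choose f hf hf6 hf1 using fun i => hlr (S.Joined a n i)
  have hopt : ((∑ i ∈ Finset.range N, f i : ℕ) : ℝ) ≤ profitOpt (inputGraph a n) :=
    Nat.cast_le.2 (sum_le_profitOpt hL hC f fun i _ => hf i)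
  have halg : (profit (S.cluster (inputGraph a n)) : ℝ) ≤
      (∑ i ∈ Finset.range N, (Plan.node l r).merges (S.Joined a n i) [] : ℕ) :=
    Nat.cast_le.2 hL.profit_le
  -- Every copy contributes `δ`: through its optimum `≥ 1` if nothing was merged in it, and through
  -- the factor `6 > R'` otherwise.
  have hcopy : ∀ i, R' * (Plan.node l r).merges (S.Joined a n i) [] + δ ≤ f i := by
    intro i
    have h6 : (6 * (Plan.node l r).merges (S.Joined a n i) [] : ℝ) ≤ f i := mod_cast hf6 i
    rcases Nat.eq_zero_or_pos ((Plan.node l r).merges (S.Joined a n i) []) with h0 | h0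
    · have h1 : (1 : ℝ) ≤ f i := mod_cast hf1 i
      rw [h0]
      have := min_le_left 1 (6 - R')
      simp only [Nat.cast_zero, mul_zero, zero_add]
      linarith
    · have h1 : (1 : ℝ) ≤ (Plan.node l r).merges (S.Joined a n i) [] := mod_cast h0
      have := min_le_right 1 (6 - R')
      nlinarith
  have hsum := Finset.sum_le_sum fun i (_ : i ∈ Finset.range N) => hcopy i
  rw [Finset.sum_add_distrib, ← Finset.mul_sum, Finset.sum_const, Finset.card_range,
    nsmul_eq_mul] at hsum
  push_cast at hopt halg
  have hcomp := hβ n (inputGraph a n)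
  have h1 : R * (profit (S.cluster (inputGraph a n)) : ℝ) ≤
      R' * ∑ i ∈ Finset.range N, ((Plan.node l r).merges (S.Joined a n i) [] : ℝ) :=
    (mul_le_mul_of_nonneg_right (le_max_left R 0) (Nat.cast_nonneg _)).trans
      (mul_le_mul_of_nonneg_left halg (le_max_right R 0))
  rw [div_lt_iff₀ hδ] at hN
  linarith

end MaxCC.OnlineStrategy

theorem mainTheorem3 (S : MaxCC.OnlineStrategy) :
    (6 : EReal) ≤ S.competitiveRatio ∧ (6 : EReal) ≤ S.absoluteCompetitiveRatio := by
  have key : ∀ R : ℝ, S.IsCompetitive R → (6 : EReal) ≤ R := fun R hR =>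
    EReal.coe_le_coe_iff.2 (MaxCC.OnlineStrategy.six_le_of_isCompetitive hR)
  constructor
  · refine le_sInf ?_
    rintro _ ⟨R, hR, rfl⟩
    exact key R hR
  · refine le_sInf ?_
    rintro _ ⟨R, hR, rfl⟩
    exact key R ⟨0, hR⟩
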